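/- \textbf{Impossibility of asymmetric key cryptography without quantum memory.} \emph{Model.} A transmission is a finite sequence of rounds; in each round a register of finitely many qubits is sent. Within a round a party may perform any quantum operation, but a party \emph{without quantum memory} keeps only classical data between rounds and before and after a transmission. So a sender without quantum memory makes random classical choices and then sends one density matrix per round, and a receiver without quantum memory measures each incoming register completely (by a POVM that may depend on all earlier outcomes) and ends with a classical result. A \emph{0-qmemory asymmetric key encryption scheme} consists, for each security parameter $\lambda$, of: $\mathsf{Gen}(1^\lambda)$, which samples a classical private key $sk\in\{0,1\}^{p(\lambda)}$ with $p$ polynomially bounded; $\mathsf{KeySend}(sk)$, which sends a (classical, pure or mixed) quantum public key copy $\rho_{pk}$; $\mathsf{KeyReceive}(\rho_{pk})$, which extracts a classical key $k$ (a bit string) from it; $\mathsf{Enc}(k,\mu)$, which sends a quantum ciphertext for a message $\mu\in\mathcal M_\lambda$; and $\mathsf{Dec}(sk,\cdot)$, which receives a ciphertext and outputs a message; all of these run without quantum memory. In a \emph{0-qmemory signature scheme}, $\mathsf{Enc},\mathsf{Dec}$ are replaced by $\mathsf{Sign}(sk,\mu)$, which sends a quantum signature, and $\mathsf{Verify}(k,\mu,\cdot)$,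 which receives a signature and outputs a bit. A scheme is \emph{correct} if for all messages $\mu=\mu_\lambda$, when $sk\leftarrow\mathsf{Gen}(1^\lambda)$ and $k\leftarrow\mathsf{KeyReceive}(\mathsf{KeySend}(sk))$, one has $\mathsf{Dec}(sk,\mathsf{Enc}(k,\mu))=\mu$, respectively $\mathsf{Verify}(k,\mu,\mathsf{Sign}(sk,\mu))=1$, with probability at least $1-\mathrm{negl}(\lambda)$. No bound on the running time of the honest parties is assumed. Adversaries are computationally unbounded, have no quantum memory, and make at most polynomially many oracle queries, in particular any polynomial number of queries to $\mathsf{KeySend}(sk)$ (each giving a fresh public key copy); each oracle transmission is processed before the next query is made. In all experiments $sk$ is sampled by $\mathsf{Gen}(1^\lambda)$ and $k$ is extracted from one public key copy, hidden from the adversary. \textbf{Theorem.} There is no secure correct 0-qmemory asymmetric key scheme. Precisely: (1) Let $\Pi$ be a correct 0-qmemory asymmetric key encryption scheme with $|\mathcal M_\lambda|\ge 2$ for all $\lambda$. Then: (a) for all messages $\mu_0\ne\mu_1$ (families with $\mu_{0,\lambda}\neq\mu_{1,\lambda}$ for all $\lambda$), it is not the case that every adversary that has only public key copies and then gets $\mathsf{Enc}(k,\mu_b)$,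 for a uniform bit $b$, guesses $b$ with probability at most $\frac12+\mathrm{negl}(\lambda)$; (b) $\Pi$ is not qDCCA1-secure: it is not the case that every adversary that, with access to $\mathsf{KeySend}(sk)$, $\mathsf{Enc}(k,\cdot)$, $\mathsf{Dec}(sk,\cdot)$, chooses two messages $m_0,m_1$, then receives $\mathsf{Enc}(k,m_b)$ and afterwards $sk$, and from then on has access to $\mathsf{KeySend}(sk)$, $\mathsf{Enc}(k,\cdot)$ only, guesses $b$ with probability at most $\frac12+\mathrm{negl}(\lambda)$; (c) $\Pi$ is not qUCCA-secure: it is not the case that for every adversary that chooses $m_0,m_1$ as in (b) and, while receiving $\mathsf{Enc}(k,m_b)$, feeds quantum and classical information to two isolated parties without quantum memory who know $sk$ (and at the end, after further queries to $\mathsf{KeySend}(sk)$ and $\mathsf{Enc}(k,\cdot)$, a last classical message), both of these output $b$ with probability at most $\frac12+\mathrm{negl}(\lambda)$. (2) Let $\Pi$ be a correct 0-qmemory signature scheme with $\mathcal M_\lambda\ne\emptyset$ for all $\lambda$. Then: (a) for every (family of) messages $\mu$, it is not the case that every adversary that has only public key copies produces a transmission accepted by $\mathsf{Verify}(k,\mu,\cdot)$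 with probability at most $\mathrm{negl}(\lambda)$; (b) $\Pi$ is not qDCMVA-secure: it is not the case that every adversary that first has access to $\mathsf{KeySend}(sk)$, $\mathsf{Sign}(sk,\cdot)$, $\mathsf{Verify}(k,\cdot)$, and then to $\mathsf{KeySend}(sk)$, $\mathsf{Verify}(k,\cdot)$ only, outputs a message and a signature accepted by $\mathsf{Verify}(k,\cdot)$ with probability at most $\mathrm{negl}(\lambda)$; (c) $\Pi$ is not qUCVA-secure: it is not the case that every adversary with access to $\mathsf{KeySend}(sk)$, $\mathsf{Verify}(k,\cdot)$ and at most one query to $\mathsf{Sign}(sk,\cdot)$ outputs two pairs of a message and a signature that are both accepted with probability at most $\mathrm{negl}(\lambda)$. -/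

import Mathlib

open scoped Matrix Kronecker ComplexOrder MatrixOrder

/-! ### Asymptotics -/

/-- Negligible functions of the security parameter: eventually smaller than the inverse of
every polynomial. -/
def Negligible (ν : ℕ → ℝ) : Prop :=
  Asymptotics.SuperpolynomialDecay Filter.atTop (fun n : ℕ => (n : ℝ)) ν

def PolyBounded (t : ℕ → ℕ) : Prop :=
  ∃ P : Polynomial ℕ, ∀ n, t n ≤ P.eval n

/-! ### States and measurements of a register of `d` qubits -/

/-- Labels of the computational basis of `d` qubits. -/
abbrev Qubits (d : ℕ) : Type := Fin d → Bool

/-- Density matrices of `d` qubits (pure, mixed, or classical, i.e. diagonal). -/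
structure Density (d : ℕ) where
  mat : Matrix (Qubits d) (Qubits d) ℂ
  posSemidef : mat.PosSemidef
  trace_eq_one : mat.trace = 1

/-- Measurements of `d` qubits with classical outcomes in `ι`. -/
structure POVM (d : ℕ) (ι : Type) [Fintype ι] where
  effect : ι → Matrix (Qubits d) (Qubits d) ℂ
  posSemidef : ∀ i, (effect i).PosSemidef
  sum_eq_one : ∑ i, effect i = 1

theorem trace_mul_re_nonneg {d : ℕ} {E ρ : Matrix (Qubits d) (Qubits d) ℂ}
    (hE : E.PosSemidef) (hρ : ρ.PosSemidef) : 0 ≤ (E * ρ).trace.re := by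
  obtain ⟨B, rfl⟩ := CStarAlgebra.nonneg_iff_eq_star_mul_self.1 hE.nonneg
  rw [Matrix.star_eq_conjTranspose]
  have h : (Bᴴ * B * ρ).trace = (B * ρ * Bᴴ).trace := by
    rw [Matrix.mul_assoc, Matrix.trace_mul_comm]
  rw [h]
  exact (Complex.le_def.1 (hρ.mul_mul_conjTranspose_same B).trace_nonneg).1

theorem born_sum {d : ℕ} {ι : Type} [Fintype ι] (E : POVM d ι) (ρ : Density d) :
    ∑ i, ENNReal.ofReal ((E.effect i * ρ.mat).trace.re) = 1 := by
  rw [← ENNReal.ofReal_sum_of_nonneg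
    (fun i _ => trace_mul_re_nonneg (E.posSemidef i) ρ.posSemidef), ← Complex.re_sum,
    ← Matrix.trace_sum, ← Finset.sum_mul, E.sum_eq_one, Matrix.one_mul, ρ.trace_eq_one]
  simp

/-- The law of the outcome of a measurement (Born rule): outcome `i` has probability
`tr (Eᵢ ρ)`. -/
noncomputable def POVM.measure {d : ℕ} {ι : Type} [Fintype ι] (E : POVM d ι) (ρ : Density d) :
    PMF ι :=
  PMF.ofFintype (fun i => ENNReal.ofReal ((E.effect i * ρ.mat).trace.re)) (born_sum E ρ)

/-! ### Transmissions between parties without quantum memory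

A transmission is a sequence of rounds. Its format is the list of the numbers of qubits sent in
the rounds. Within a round a party may perform any quantum operation; between two rounds, and
before and after the transmission, a party without quantum memory keeps classical data only. -/

/-- What is sent in a transmission of format `ds` once the classical random choices of the sender
are fixed: one state for each round. A sender without quantum memory cannot entangle the rounds, so
its transmission is a random element of this type, i.e. a `PMF (Signal ds)`. -/
def Signal : List ℕ → Type
  | [] => Unit
  | d :: ds => Density d × Signal ds

/-- A receiver without quantum memory, with a classical result in `α`: in every round it measures
the whole incoming register; the measurement may depend on all previous outcomes. After the last
round it outputs a (possibly random) result. -/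
def Receiver (α : Type) : List ℕ → Type
  | [] => PMF α
  | d :: ds => Σ m : ℕ, POVM d (Fin m) × (Fin m → Receiver α ds)

/-- The law of the result of a receiver. -/
noncomputable def Receiver.run {α : Type} : {ds : List ℕ} → Receiver α ds → Signal ds → PMF α
  | [], R, _ => R
  | _ :: _, ⟨_, E, next⟩, (ρ, σ) => (E.measure ρ).bind fun i => (next i).run σ

/-! ### Oracle programs: parties with classical memory and unlimited computing power

There is no restriction on the computing power, only a count of the queries. A transmission that
an oracle sends is processed to its end before the next query; this keeps the class of adversaries
small, so that security against it asks for less. -/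

/-- Randomized adaptive programs that ask oracle queries `q : Q`, answered in `A q`. -/
inductive Prog (Q : Type) (A : Q → Type) (α : Type) : Type
  | ret (a : α) : Prog Q A α
  | coin (p : PMF ℕ) (next : ℕ → Prog Q A α) : Prog Q A α
  | ask (q : Q) (next : A q → Prog Q A α) : Prog Q A α

noncomputable def Prog.eval {Q : Type} {A : Q → Type} {α : Type} (oracle : ∀ q, PMF (A q)) :
    Prog Q A α → PMF α
  | .ret a => PMF.pure a
  | .coin p next => p.bind fun i => (next i).eval oracle
  | .ask q next => (oracle q).bind fun a => (next a).eval oracle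

/-- On every execution path the total weight of the queries is at most `t`, where the query `q`
has the weight `w q`. -/
def Prog.CostLE {Q : Type} {A : Q → Type} {α : Type} (w : Q → ℕ) : Prog Q A α → ℕ → Prop
  | .ret _, _ => True
  | .coin _ next, t => ∀ i, (next i).CostLE w t
  | .ask q next, t => w q ≤ t ∧ ∀ a, (next a).CostLE w (t - w q)

/-- The classical memory of an adversary. -/
abbrev Bits : Type := List Bool

noncomputable def fairCoin : PMF Bool := PMF.uniformOfFintype Bool

/-! ### Splitting a transmission into two pieces -/

/-- A quantum instrument from `d` qubits to two registers of `d₁` and `d₂` qubits, with classical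
outcomes in `Fin m`; the Kraus operators of the outcome `j` are `kraus j k`. -/
structure SplitOp (d d₁ d₂ m r : ℕ) where
  kraus : Fin m → Fin r → Matrix (Qubits d₁ × Qubits d₂) (Qubits d) ℂ
  sum_eq_one : ∑ j, ∑ k, (kraus j k)ᴴ * kraus j k = 1

/-- Apply the instrument, then measure the two output registers separately; this is a measurement
of the input register. -/
noncomputable def SplitOp.join {d d₁ d₂ m r m₁ m₂ : ℕ} (K : SplitOp d d₁ d₂ m r)
    (E₁ : POVM d₁ (Fin m₁)) (E₂ : POVM d₂ (Fin m₂)) : POVM d (Fin m × Fin m₁ × Fin m₂) where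
  effect x := ∑ k, (K.kraus x.1 k)ᴴ * (E₁.effect x.2.1 ⊗ₖ E₂.effect x.2.2) * K.kraus x.1 k
  posSemidef x := Matrix.posSemidef_sum _ fun _ _ =>
    ((E₁.posSemidef _).kronecker (E₂.posSemidef _)).conjTranspose_mul_mul_same _
  sum_eq_one := by
    have h : ∑ a, ∑ b, E₁.effect a ⊗ₖ E₂.effect b = 1 := by
      rw [← Matrix.one_kronecker_one, ← E₁.sum_eq_one, ← E₂.sum_eq_one]
      ext i j
      simp [Matrix.sum_apply, Matrix.kroneckerMap_apply, Finset.sum_mul_sum]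
    rw [Fintype.sum_prod_type, ← K.sum_eq_one]
    refine Finset.sum_congr rfl fun j _ => ?_
    rw [Finset.sum_comm]
    refine Finset.sum_congr rfl fun k _ => ?_
    dsimp only
    rw [← Matrix.sum_mul, ← Matrix.mul_sum, Fintype.sum_prod_type, h, Matrix.mul_one]

/-- A party without quantum memory that, while it receives a transmission, feeds registers of
`f₁` and `f₂` qubits to two other parties in every round. -/
def Splitter (α : Type) (f₁ f₂ : ℕ) : List ℕ → Type
  | [] => α
  | d :: ds => Σ m : ℕ, Σ r : ℕ, SplitOp d f₁ f₂ m r × (Fin m → Splitter α f₁ f₂ ds)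

/-- The joint law of the results of a splitter and of the two isolated parties it feeds. -/
noncomputable def Splitter.run {α β γ : Type} {f₁ f₂ : ℕ} : {ds : List ℕ} →
    Splitter α f₁ f₂ ds → Receiver β (ds.map fun _ => f₁) → Receiver γ (ds.map fun _ => f₂) →
    Signal ds → PMF (α × β × γ)
  | [], a, R₁, R₂, _ =>
      (show PMF β from R₁).bind fun b => (show PMF γ from R₂).map fun c => (a, b, c)
  | _ :: _, ⟨_, _, K, next⟩, ⟨_, E₁, next₁⟩, ⟨_, E₂, next₂⟩, (ρ, σ) =>
      ((K.join E₁ E₂).measure ρ).bind fun x =>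
        (next x.1).run (next₁ x.2.1) (next₂ x.2.2) σ

/-! ### Asymmetric key encryption without quantum memory -/

/-- An asymmetric key encryption scheme, with quantum public keys and quantum ciphertexts, in
which no honest party needs quantum memory. `Msg n` is the message space for the security
parameter `n`. Everything an honest party keeps is classical: the private key, a bit string of
polynomial length, and the key extracted from a copy of the public key, a bit string. -/
structure EncScheme (Msg : ℕ → Type) where
  skLen : ℕ → ℕ
  skLen_poly : PolyBounded skLen
  keyLen : ℕ → ℕ
  pkFmt : ℕ → List ℕ
  ctFmt : ℕ → List ℕ
  gen : ∀ n, PMF (Fin (skLen n) → Bool)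
  keySend : ∀ n, (Fin (skLen n) → Bool) → PMF (Signal (pkFmt n))
  keyReceive : ∀ n, Receiver (Fin (keyLen n) → Bool) (pkFmt n)
  enc : ∀ n, (Fin (keyLen n) → Bool) → Msg n → PMF (Signal (ctFmt n))
  dec : ∀ n, (Fin (skLen n) → Bool) → Receiver (Msg n) (ctFmt n)

namespace EncScheme

variable {Msg : ℕ → Type}

abbrev SK (S : EncScheme Msg) (n : ℕ) : Type := Fin (S.skLen n) → Bool

abbrev Key (S : EncScheme Msg) (n : ℕ) : Type := Fin (S.keyLen n) → Bool

/-- A private key and a key extracted by an honest user from one copy of the public key. -/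
noncomputable def setup (S : EncScheme Msg) (n : ℕ) : PMF (S.SK n × S.Key n) := do
  let sk ← S.gen n
  let ρ ← S.keySend n sk
  let k ← (S.keyReceive n).run ρ
  return (sk, k)

noncomputable def decryption (S : EncScheme Msg) (n : ℕ) (μ : Msg n) : PMF (Msg n) := do
  let (sk, k) ← S.setup n
  let ρ ← S.enc n k μ
  (S.dec n sk).run ρ

def Correct (S : EncScheme Msg) : Prop :=
  ∀ μ : ∀ n, Msg n, ∃ ν, Negligible ν ∧ ∀ n, 1 - ν n ≤ (S.decryption n (μ n) (μ n)).toReal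

/-- Oracle queries: a fresh copy of the public key, processed without quantum memory; an
encryption of a chosen message, processed likewise; a decryption of a chosen transmission. -/
inductive Query (S : EncScheme Msg) (n : ℕ) : Type
  | key (R : Receiver Bits (S.pkFmt n))
  | enc (μ : Msg n) (R : Receiver Bits (S.ctFmt n))
  | dec (ρ : Signal (S.ctFmt n))

def Answer (S : EncScheme Msg) (n : ℕ) : S.Query n → Type
  | .key _ => Bits
  | .enc _ _ => Bits
  | .dec _ => Msg n

noncomputable def oracle (S : EncScheme Msg) (n : ℕ) (sk : S.SK n) (k : S.Key n) :
    ∀ q : S.Query n, PMF (S.Answer n q)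
  | .key R => (S.keySend n sk).bind fun ρ => R.run ρ
  | .enc μ R => (S.enc n k μ).bind fun ρ => R.run ρ
  | .dec ρ => (S.dec n sk).run ρ

def decWeight (S : EncScheme Msg) (n : ℕ) : S.Query n → ℕ
  | .dec _ => 1
  | _ => 0

def nonKeyWeight (S : EncScheme Msg) (n : ℕ) : S.Query n → ℕ
  | .key _ => 0
  | _ => 1

abbrev Attack (S : EncScheme Msg) (n : ℕ) (α : Type) : Type := Prog (S.Query n) (S.Answer n) α

/-! #### Indistinguishability of two given messages under a key-only attack -/

/-- The adversary sees copies of the public key, then processes the challenge ciphertext and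
guesses which of the two messages it encrypts. -/
noncomputable def keyOnlyExp (S : EncScheme Msg) (n : ℕ) (μ₀ μ₁ : Msg n)
    (adv : S.Attack n (Receiver Bool (S.ctFmt n))) : PMF Bool := do
  let (sk, k) ← S.setup n
  let b ← fairCoin
  let R ← adv.eval (S.oracle n sk k)
  let ρ ← S.enc n k (if b then μ₁ else μ₀)
  let b' ← R.run ρ
  return b' == b

/-- Security of two given (families of) messages against adversaries without quantum memory that
get polynomially many copies of the public key and nothing else. -/
def KeyOnlyIndist (S : EncScheme Msg) (μ₀ μ₁ : ∀ n, Msg n) : Prop :=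
  ∀ adv : ∀ n, S.Attack n (Receiver Bool (S.ctFmt n)),
    (∃ t, PolyBounded t ∧ ∀ n, (adv n).CostLE (fun _ => 1) (t n)) →
    (∀ n, (adv n).CostLE (S.nonKeyWeight n) 0) →
    ∃ ν, Negligible ν ∧
      ∀ n, (S.keyOnlyExp n (μ₀ n) (μ₁ n) (adv n) true).toReal ≤ 1 / 2 + ν n

/-! #### Disappearing indistinguishability under chosen ciphertext attacks -/

/-- `choose` selects two messages and the way in which the challenge ciphertext is going to be
processed; `guess` gets the classical data extracted from the ciphertext, and the private key. -/
structure DisAdversary (S : EncScheme Msg) where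
  choose : ∀ n, S.Attack n (Msg n × Msg n × Receiver Bits (S.ctFmt n))
  guess : ∀ n, Bits → S.SK n → S.Attack n Bool

/-- Polynomially many queries, and no decryption query after the challenge. -/
def DisAdversary.Admissible {S : EncScheme Msg} (adv : S.DisAdversary) : Prop :=
  ∃ t, PolyBounded t ∧ ∀ n, (adv.choose n).CostLE (fun _ => 1) (t n) ∧
    ∀ x sk, (adv.guess n x sk).CostLE (fun _ => 1) (t n) ∧
      (adv.guess n x sk).CostLE (S.decWeight n) 0

noncomputable def disExp (S : EncScheme Msg) (adv : S.DisAdversary) (n : ℕ) : PMF Bool := do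
  let (sk, k) ← S.setup n
  let b ← fairCoin
  let (m₀, m₁, R) ← (adv.choose n).eval (S.oracle n sk k)
  let ρ ← S.enc n k (if b then m₁ else m₀)
  let x ← R.run ρ
  let b' ← (adv.guess n x sk).eval (S.oracle n sk k)
  return b' == b

/-- qDCCA1 security against adversaries without quantum memory. -/
def QDCCA1 (S : EncScheme Msg) : Prop :=
  ∀ adv : S.DisAdversary, adv.Admissible →
    ∃ ν, Negligible ν ∧ ∀ n, (S.disExp adv n true).toReal ≤ 1 / 2 + ν n

/-! #### Unclonable security under chosen ciphertext attacks -/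

/-- `choose` selects two messages and the way in which the challenge ciphertext is split. The two
isolated parties `fst` and `snd` know the private key and are fed registers of `f₁ n` and `f₂ n`
qubits in every round. In the end `finish` sends each of them a classical message, and each of
them outputs a guess. -/
structure UncAdversary (S : EncScheme Msg) where
  f₁ : ℕ → ℕ
  f₂ : ℕ → ℕ
  choose : ∀ n, S.Attack n (Msg n × Msg n × Splitter Bits (f₁ n) (f₂ n) (S.ctFmt n))
  finish : ∀ n, Bits → S.Attack n (Bits × Bits)
  fst : ∀ n, S.SK n → Receiver (Bits → PMF Bool) ((S.ctFmt n).map fun _ => f₁ n)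
  snd : ∀ n, S.SK n → Receiver (Bits → PMF Bool) ((S.ctFmt n).map fun _ => f₂ n)

/-- Polynomially many queries, and no decryption query after the challenge. -/
def UncAdversary.Admissible {S : EncScheme Msg} (adv : S.UncAdversary) : Prop :=
  ∃ t, PolyBounded t ∧ ∀ n, (adv.choose n).CostLE (fun _ => 1) (t n) ∧
    ∀ x, (adv.finish n x).CostLE (fun _ => 1) (t n) ∧
      (adv.finish n x).CostLE (S.decWeight n) 0

noncomputable def uncExp (S : EncScheme Msg) (adv : S.UncAdversary) (n : ℕ) : PMF Bool := do
  let (sk, k) ← S.setup n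
  let b ← fairCoin
  let (m₀, m₁, T) ← (adv.choose n).eval (S.oracle n sk k)
  let ρ ← S.enc n k (if b then m₁ else m₀)
  let (x, g₁, g₂) ← T.run (adv.fst n sk) (adv.snd n sk) ρ
  let (y₁, y₂) ← (adv.finish n x).eval (S.oracle n sk k)
  let b₁ ← g₁ y₁
  let b₂ ← g₂ y₂
  return b₁ == b && b₂ == b

/-- qUCCA security against adversaries without quantum memory. -/
def QUCCA (S : EncScheme Msg) : Prop :=
  ∀ adv : S.UncAdversary, adv.Admissible →
    ∃ ν, Negligible ν ∧ ∀ n, (S.uncExp adv n true).toReal ≤ 1 / 2 + ν n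

end EncScheme

/-! ### Signatures without quantum memory -/

/-- A signature scheme, with quantum public keys and quantum signatures, in which no honest party
needs quantum memory. -/
structure SigScheme (Msg : ℕ → Type) where
  skLen : ℕ → ℕ
  skLen_poly : PolyBounded skLen
  keyLen : ℕ → ℕ
  pkFmt : ℕ → List ℕ
  sigFmt : ℕ → List ℕ
  gen : ∀ n, PMF (Fin (skLen n) → Bool)
  keySend : ∀ n, (Fin (skLen n) → Bool) → PMF (Signal (pkFmt n))
  keyReceive : ∀ n, Receiver (Fin (keyLen n) → Bool) (pkFmt n)
  sign : ∀ n, (Fin (skLen n) → Bool) → Msg n → PMF (Signal (sigFmt n))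
  verify : ∀ n, (Fin (keyLen n) → Bool) → Msg n → Receiver Bool (sigFmt n)

namespace SigScheme

variable {Msg : ℕ → Type}

abbrev SK (S : SigScheme Msg) (n : ℕ) : Type := Fin (S.skLen n) → Bool

abbrev Key (S : SigScheme Msg) (n : ℕ) : Type := Fin (S.keyLen n) → Bool

/-- A private key and a key extracted by an honest user from one copy of the public key. -/
noncomputable def setup (S : SigScheme Msg) (n : ℕ) : PMF (S.SK n × S.Key n) := do
  let sk ← S.gen n
  let ρ ← S.keySend n sk
  let k ← (S.keyReceive n).run ρ
  return (sk, k)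

noncomputable def verification (S : SigScheme Msg) (n : ℕ) (μ : Msg n) : PMF Bool := do
  let (sk, k) ← S.setup n
  let ρ ← S.sign n sk μ
  (S.verify n k μ).run ρ

def Correct (S : SigScheme Msg) : Prop :=
  ∀ μ : ∀ n, Msg n, ∃ ν, Negligible ν ∧ ∀ n, 1 - ν n ≤ (S.verification n (μ n) true).toReal

/-- Oracle queries: a fresh copy of the public key, processed without quantum memory; a signature
of a chosen message, processed likewise; the verification of a chosen message and transmission. -/
inductive Query (S : SigScheme Msg) (n : ℕ) : Type
  | key (R : Receiver Bits (S.pkFmt n))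
  | sign (μ : Msg n) (R : Receiver Bits (S.sigFmt n))
  | verify (μ : Msg n) (ρ : Signal (S.sigFmt n))

def Answer (S : SigScheme Msg) (n : ℕ) : S.Query n → Type
  | .key _ => Bits
  | .sign _ _ => Bits
  | .verify _ _ => Bool

noncomputable def oracle (S : SigScheme Msg) (n : ℕ) (sk : S.SK n) (k : S.Key n) :
    ∀ q : S.Query n, PMF (S.Answer n q)
  | .key R => (S.keySend n sk).bind fun ρ => R.run ρ
  | .sign μ R => (S.sign n sk μ).bind fun ρ => R.run ρ
  | .verify μ ρ => (S.verify n k μ).run ρ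

def signWeight (S : SigScheme Msg) (n : ℕ) : S.Query n → ℕ
  | .sign _ _ => 1
  | _ => 0

def nonKeyWeight (S : SigScheme Msg) (n : ℕ) : S.Query n → ℕ
  | .key _ => 0
  | _ => 1

abbrev Attack (S : SigScheme Msg) (n : ℕ) (α : Type) : Type := Prog (S.Query n) (S.Answer n) α

/-! #### Unforgeability of a given message under a key-only attack -/

noncomputable def keyOnlyExp (S : SigScheme Msg) (n : ℕ) (μ : Msg n)
    (adv : S.Attack n (Signal (S.sigFmt n))) : PMF Bool := do
  let (sk, k) ← S.setup n
  let ρ ← adv.eval (S.oracle n sk k)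
  (S.verify n k μ).run ρ

/-- No adversary without quantum memory that gets polynomially many copies of the public key, and
nothing else, can forge a signature of the given (family of) messages. -/
def KeyOnlyUnforgeable (S : SigScheme Msg) (μ : ∀ n, Msg n) : Prop :=
  ∀ adv : ∀ n, S.Attack n (Signal (S.sigFmt n)),
    (∃ t, PolyBounded t ∧ ∀ n, (adv n).CostLE (fun _ => 1) (t n)) →
    (∀ n, (adv n).CostLE (S.nonKeyWeight n) 0) →
    ∃ ν, Negligible ν ∧ ∀ n, (S.keyOnlyExp n (μ n) (adv n) true).toReal ≤ ν n

/-! #### Disappearing security under chosen message and verification attacks -/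

/-- `learn` may use all oracles; `forge` may not ask for signatures. -/
structure DisAdversary (S : SigScheme Msg) where
  learn : ∀ n, S.Attack n Bits
  forge : ∀ n, Bits → S.Attack n (Msg n × Signal (S.sigFmt n))

def DisAdversary.Admissible {S : SigScheme Msg} (adv : S.DisAdversary) : Prop :=
  ∃ t, PolyBounded t ∧ ∀ n, (adv.learn n).CostLE (fun _ => 1) (t n) ∧
    ∀ x, (adv.forge n x).CostLE (fun _ => 1) (t n) ∧
      (adv.forge n x).CostLE (S.signWeight n) 0

noncomputable def disExp (S : SigScheme Msg) (adv : S.DisAdversary) (n : ℕ) : PMF Bool := do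
  let (sk, k) ← S.setup n
  let x ← (adv.learn n).eval (S.oracle n sk k)
  let (μ, ρ) ← (adv.forge n x).eval (S.oracle n sk k)
  (S.verify n k μ).run ρ

/-- qDCMVA security against adversaries without quantum memory. -/
def QDCMVA (S : SigScheme Msg) : Prop :=
  ∀ adv : S.DisAdversary, adv.Admissible →
    ∃ ν, Negligible ν ∧ ∀ n, (S.disExp adv n true).toReal ≤ ν n

/-! #### Unclonable security under chosen verification attacks -/

/-- An adversary that outputs two signed messages. -/
abbrev UncAdversary (S : SigScheme Msg) : Type :=
  ∀ n, S.Attack n ((Msg n × Signal (S.sigFmt n)) × (Msg n × Signal (S.sigFmt n)))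

/-- Polynomially many queries, among them at most one signature query. -/
def UncAdmissible {S : SigScheme Msg} (adv : S.UncAdversary) : Prop :=
  ∃ t, PolyBounded t ∧ ∀ n, (adv n).CostLE (fun _ => 1) (t n) ∧
    (adv n).CostLE (S.signWeight n) 1

noncomputable def uncExp (S : SigScheme Msg) (adv : S.UncAdversary) (n : ℕ) : PMF Bool := do
  let (sk, k) ← S.setup n
  let ((μ, ρ), (μ', ρ')) ← (adv n).eval (S.oracle n sk k)
  let v ← (S.verify n k μ).run ρ
  let v' ← (S.verify n k μ').run ρ'
  return v && v'

/-- qUCVA security against adversaries without quantum memory. -/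
def QUCVA (S : SigScheme Msg) : Prop :=
  ∀ adv : S.UncAdversary, UncAdmissible adv →
    ∃ ν, Negligible ν ∧ ∀ n, (S.uncExp adv n true).toReal ≤ ν n

end SigScheme

/-! The key `k` of an honest user is classical, and given `sk` it is one sample of a law `extract
sk`. An adversary that processes its public key copies exactly as an honest user does obtains
further samples of this law, independent of `k` given `sk`. Quantum mechanics plays almost no
further role: what remains is to learn, from `T` samples, a private key that works for a fresh
sample. The true `sk` need not be found.

Let `e x k` be the probability that the private key `x` fails on the extracted key `k`; it is
computable without queries by an unbounded adversary. Given samples `k₁, …, k_T`, take `x` that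
maximizes the score `∏ (1 - e x kᵢ)`. The true key has score at least `1 - ∑ e sk kᵢ`, which is
close to 1 on average by correctness. A key whose mean failure probability exceeds `ε` has expected
score at most `(1 - ε) ^ T`, and there are only `2 ^ p` keys. Hence the chosen key fails on a fresh
sample with probability at most `ε + T η + 2 ^ p (1 - ε) ^ T`, where `η` is the mean failure
probability of the true key (`exists_learner`). As `p` is polynomial, some polynomial `T` makes this
eventually at most `1/8`.

The substitute key then decrypts the challenge or signs a message (`attackError`, `forgeryError`).
All six attacks are of this kind; the two against unclonable security lose a further factor 2, which
still leaves an error of at most `1/4`. -/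

/-! ### Expectations of extended nonnegative functions -/

namespace PMF

variable {α β : Type*}

/-- The expectation of `f` under the law `p`. -/
noncomputable def expect (p : PMF α) (f : α → ENNReal) : ENNReal := ∑' a, p a * f a

theorem bind_apply_eq_expect (p : PMF α) (f : α → PMF β) (b : β) :
    p.bind f b = p.expect fun a => f a b := rfl

theorem expect_pure (a : α) (f : α → ENNReal) : (pure a).expect f = f a := by
  classical
  rw [expect, tsum_eq_single a]
  · simp
  · intro b hb
    simp [hb]

theorem expect_bind (p : PMF α) (q : α → PMF β) (f : β → ENNReal) :
    (p.bind q).expect f = p.expect fun a => (q a).expect f := by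
  simp only [expect, bind_apply, ← ENNReal.tsum_mul_left, ← ENNReal.tsum_mul_right]
  rw [ENNReal.tsum_comm]
  simp only [mul_assoc]

theorem expect_mono (p : PMF α) {f g : α → ENNReal} (h : ∀ a, f a ≤ g a) :
    p.expect f ≤ p.expect g :=
  ENNReal.tsum_le_tsum fun a => mul_le_mul_right (h a) _

theorem expect_const (p : PMF α) (c : ENNReal) : (p.expect fun _ => c) = c := by
  rw [expect, ENNReal.tsum_mul_right, p.tsum_coe, one_mul]

theorem expect_add (p : PMF α) (f g : α → ENNReal) :
    (p.expect fun a => f a + g a) = p.expect f + p.expect g := by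
  simp only [expect, mul_add, ENNReal.tsum_add]

theorem expect_const_mul (p : PMF α) (c : ENNReal) (f : α → ENNReal) :
    (p.expect fun a => c * f a) = c * p.expect f := by
  simp only [expect, mul_left_comm _ c, ENNReal.tsum_mul_left]

theorem expect_finset_sum {ι : Type*} (p : PMF α) (s : Finset ι) (f : ι → α → ENNReal) :
    (p.expect fun a => ∑ i ∈ s, f i a) = ∑ i ∈ s, p.expect (f i) := by
  classical
  induction s using Finset.induction_on with
  | empty => simp [expect]
  | insert i s hi ih => simp only [Finset.sum_insert hi, expect_add, ih]

theorem expect_comm (p : PMF α) (q : PMF β) (f : α → β → ENNReal) :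
    (p.expect fun a => q.expect (f a)) = q.expect fun b => p.expect fun a => f a b := by
  simp only [expect, ← ENNReal.tsum_mul_left]
  rw [ENNReal.tsum_comm]
  simp only [mul_left_comm]

theorem expect_le_one (p : PMF α) {f : α → ENNReal} (h : ∀ a, f a ≤ 1) : p.expect f ≤ 1 :=
  (p.expect_mono h).trans_eq (p.expect_const 1)

theorem expect_one_sub (p : PMF α) {f : α → ENNReal} (h : ∀ a, f a ≤ 1) :
    (p.expect fun a => 1 - f a) = 1 - p.expect f := by
  refine ENNReal.eq_sub_of_add_eq (ne_top_of_le_ne_top ENNReal.one_ne_top (p.expect_le_one h)) ?_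
  rw [← expect_add]
  simp only [tsub_add_cancel_of_le (h _), expect_const]

theorem bool_apply_true (p : PMF Bool) : p true = 1 - p false := by
  refine ENNReal.eq_sub_of_add_eq (p.apply_ne_top _) ?_
  simpa [tsum_fintype] using p.tsum_coe

theorem bool_apply_not (p : PMF Bool) (b : Bool) : p (!b) = 1 - p b := by
  cases b
  · exact p.bool_apply_true
  · have h := p.bool_apply_true
    rw [Bool.not_true, h, ENNReal.sub_sub_cancel ENNReal.one_ne_top (p.coe_le_one _)]

theorem expect_pure_beq (p : PMF Bool) (b : Bool) :
    (p.expect fun b' => pure (b' == b) false) = p (!b) := by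
  cases b <;> simp [expect, tsum_fintype]

/-- Union bound for two independent verifications of the same signature. -/
theorem expect_pure_and_le (p : PMF Bool) :
    (p.expect fun v => p.expect fun v' => pure (v && v') false) ≤ 2 * p false := by
  have h : p true + p false = 1 := by simpa [tsum_fintype] using p.tsum_coe
  simp only [expect, tsum_fintype, Fintype.sum_bool, two_mul]
  simp only [pure_apply]
  simp only [Bool.and_true, Bool.and_false, if_true, mul_zero, zero_add, mul_one, h,
    Bool.false_eq_true, if_false]
  gcongr
  exact mul_le_of_le_one_left' (p.coe_le_one _)

theorem apply_le_map_apply (p : PMF α) (f : α → β) (a : α) : p a ≤ p.map f (f a) := by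
  classical
  rw [map_apply]
  refine le_trans ?_ (ENNReal.le_tsum a)
  simp

/-- Every discrete law is the law of a function of a random natural number. -/
theorem exists_map_nat_eq (p : PMF α) : ∃ (q : PMF ℕ) (f : ℕ → α), q.map f = p := by
  classical
  obtain ⟨a₀, h₀⟩ := p.support_nonempty
  have : Nonempty α := ⟨a₀⟩
  have : Countable p.support := p.support_countable
  obtain ⟨e, he⟩ := exists_injective_nat p.support
  -- Only injectivity on the countable support matters; the value 0 elsewhere is taken with
  -- probability zero.
  let enc : α → ℕ := fun a => if h : a ∈ p.support then e ⟨a, h⟩ else 0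
  have hinj : Set.InjOn enc p.support := by
    intro a ha b hb hab
    simp only [enc, dif_pos ha, dif_pos hb] at hab
    exact congrArg Subtype.val (he hab)
  refine ⟨p.map enc, Function.invFunOn enc p.support, ?_⟩
  rw [map_comp]
  refine PMF.ext fun b => ?_
  rw [map, bind_apply]
  conv_rhs => rw [← p.bind_pure, bind_apply]
  refine tsum_congr fun a => ?_
  by_cases ha : a ∈ p.support
  · rw [Function.comp_apply, Function.comp_apply, hinj.leftInvOn_invFunOn ha]
  · rw [(p.apply_eq_zero_iff a).2 ha, zero_mul, zero_mul]

/-- `T` independent samples of `p`, put in front of a given list. -/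
noncomputable def samples (p : PMF α) : ℕ → List α → PMF (List α)
  | 0, l => pure l
  | T + 1, l => p.bind fun a => samples p T (a :: l)

/-- Independence turns the expected product into a power, so the score of a poor hypothesis decays
exponentially in the number of samples. The initial list `l` is what the induction carries along. -/
theorem expect_samples_prod (p : PMF α) (s : α → ENNReal) (T : ℕ) (l : List α) :
    ((p.samples T l).expect fun l' => (l'.map s).prod) = p.expect s ^ T * (l.map s).prod := by
  induction T generalizing l with
  | zero => simp [samples, expect_pure]
  | succ T ih =>
    simp only [samples, expect_bind, ih, List.map_cons, List.prod_cons]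
    simp only [mul_comm (s _), ← mul_assoc, expect_const_mul]
    ring

theorem expect_samples_sum (p : PMF α) (s : α → ENNReal) (T : ℕ) (l : List α) :
    ((p.samples T l).expect fun l' => (l'.map s).sum) = T * p.expect s + (l.map s).sum := by
  induction T generalizing l with
  | zero => simp [samples, expect_pure]
  | succ T ih =>
    simp only [samples, expect_bind, ih, List.map_cons, List.sum_cons, expect_add, expect_const]
    push_cast
    ring

end PMF

/-! ### Learning a substitute for the private key -/

/-- The union bound for independent failures: either all trials succeed or some trial fails. It
bounds the score of the true hypothesis from below without subtraction. -/
theorem one_le_prod_one_sub_add_sum {α : Type*} {e : α → ENNReal} (he : ∀ a, e a ≤ 1)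
    (l : List α) : 1 ≤ (l.map fun a => 1 - e a).prod + (l.map e).sum := by
  induction l with
  | nil => simp
  | cons a l ih =>
    simp only [List.map_cons, List.prod_cons, List.sum_cons]
    have hP : (l.map fun a => 1 - e a).prod ≤ 1 := by
      clear ih
      induction l with
      | nil => simp
      | cons b l ih => exact mul_le_one' tsub_le_self ih
    set P := (l.map fun a => 1 - e a).prod
    calc (1 : ENNReal) ≤ P + (l.map e).sum := ih
      _ = (1 - e a + e a) * P + (l.map e).sum := by rw [tsub_add_cancel_of_le (he a), one_mul]
      _ = (1 - e a) * P + (e a * P + (l.map e).sum) := by ring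
      _ ≤ _ := by
        gcongr
        exact mul_le_of_le_one_right' hP

/-- Given the failure probabilities `e x k` of the hypotheses `x` on the instances `k`, the
hypothesis that maximizes the likelihood of success on `T` independent samples of an unknown law
`D x` has a small failure probability on a fresh sample, if `x` itself has. -/
theorem exists_learner {X K : Type} [Fintype X] (g : PMF X) (D : X → PMF K)
    {e : X → K → ENNReal} (he : ∀ x k, e x k ≤ 1) (T : ℕ) (ε : ENNReal) :
    ∃ pick : List K → X,
      (g.expect fun x => (D x).expect fun k => ((D x).samples T []).expect fun l =>
        e (pick l) k) ≤
      ε + T * (g.expect fun x => (D x).expect (e x)) + Fintype.card X * (1 - ε) ^ T := by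
  classical
  have : Nonempty X := ⟨g.support_nonempty.some⟩
  -- The probability that `x` would succeed on every sample, each tried once independently.
  let score : List K → X → ENNReal := fun l x => (l.map fun k => 1 - e x k).prod
  choose pick hpick using fun l => Finite.exists_max (score l)
  refine ⟨pick, ?_⟩
  have key : ∀ x, ((D x).expect fun k => ((D x).samples T []).expect fun l => e (pick l) k) ≤
      ε + Fintype.card X * (1 - ε) ^ T + T * (D x).expect (e x) := by
    intro x
    let F : X → ENNReal := fun y => (D x).expect (e y)
    let bad : Finset X := Finset.univ.filter fun y => ε < F y
    -- If the choice is bad, its score is one of the terms of the sum and is at least the score of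
    -- the true `x`, which together with the failures of `x` makes up at least 1. If it is good, `ε`
    -- alone suffices.
    have hpt : ∀ l, F (pick l) ≤ ε + (∑ y ∈ bad, score l y + (l.map (e x)).sum) := by
      intro l
      by_cases hb : ε < F (pick l)
      · calc F (pick l) ≤ 1 := PMF.expect_le_one _ (he _)
          _ ≤ score l x + (l.map (e x)).sum := one_le_prod_one_sub_add_sum (he x) l
          _ ≤ ∑ y ∈ bad, score l y + (l.map (e x)).sum := by
            gcongr
            exact (hpick l x).trans (Finset.single_le_sum (f := score l) (fun _ _ => zero_le)
              (Finset.mem_filter.2 ⟨Finset.mem_univ _, hb⟩))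
          _ ≤ _ := le_add_self
      · exact (not_lt.1 hb).trans le_self_add
    -- The fresh instance is independent of the samples; averaging over it first leaves `F (pick
    -- l)`.
    rw [PMF.expect_comm]
    refine (PMF.expect_mono _ hpt).trans ?_
    rw [PMF.expect_add, PMF.expect_const, PMF.expect_add, PMF.expect_finset_sum,
      PMF.expect_samples_sum, List.map_nil, List.sum_nil, add_zero, ← add_assoc]
    gcongr
    calc ∑ y ∈ bad, ((D x).samples T []).expect (fun l => score l y)
        = ∑ y ∈ bad, (1 - F y) ^ T := by
          refine Finset.sum_congr rfl fun y _ => ?_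
          simp only [score, PMF.expect_samples_prod, List.map_nil, List.prod_nil, mul_one, F,
            PMF.expect_one_sub _ (he y)]
      _ ≤ ∑ y ∈ bad, (1 - ε) ^ T := by
          refine Finset.sum_le_sum fun y hy => ?_
          have := (Finset.mem_filter.1 hy).2.le
          gcongr
      _ = bad.card * (1 - ε) ^ T := by rw [Finset.sum_const, nsmul_eq_mul]
      _ ≤ _ := by
          gcongr
          exact Finset.card_le_univ _
  refine (PMF.expect_mono _ key).trans_eq ?_
  rw [PMF.expect_add, PMF.expect_const, PMF.expect_const_mul]
  ring

/-! ### Asymptotics -/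

/-- The number of samples used to learn a private key of `p` bits. -/
def sampleCount (p : ℕ) : ℕ := 11 * (p + 10)

theorem PolyBounded.sampleCount {p : ℕ → ℕ} (hp : PolyBounded p) :
    PolyBounded fun n => sampleCount (p n) := by
  obtain ⟨P, hP⟩ := hp
  refine ⟨11 * (P + 10), fun n => ?_⟩
  have := hP n
  simp only [_root_.sampleCount, Polynomial.eval_mul, Polynomial.eval_add, Polynomial.eval_ofNat]
  omega

theorem Negligible.tendsto_zero {ν : ℕ → ℝ} (h : Negligible ν) :
    Filter.Tendsto ν Filter.atTop (nhds 0) := by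
  simpa using h 0

theorem Negligible.eventually_mul_le {ν : ℕ → ℝ} (h : Negligible ν) {t : ℕ → ℕ}
    (ht : PolyBounded t) {c : ℝ} (hc : 0 < c) : ∀ᶠ n in Filter.atTop, t n * ν n ≤ c := by
  obtain ⟨P, hP⟩ := ht
  have h' := Negligible.tendsto_zero (h.polynomial_mul (P.map (Nat.castRingHom ℝ)))
  -- Absolute values are needed because a negligible function may be negative.
  filter_upwards [h'.abs.eventually (ge_mem_nhds (by simpa using hc))] with n hn
  have hPn : (t n : ℝ) ≤ P.eval n := by exact_mod_cast hP n
  calc (t n : ℝ) * ν n ≤ t n * |ν n| := by gcongr; exact le_abs_self _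
    _ ≤ P.eval n * |ν n| := by gcongr
    _ ≤ c := by simpa [abs_mul] using hn

/-- Since `(15/16) ^ 11 < 1/2`, every 11 samples halve the bound: `p` such blocks offset the `2 ^ p`
candidate keys, and the remaining ten leave `2 ^ (-10)`. -/
theorem two_pow_mul_pow_sampleCount_le (p : ℕ) :
    (2 : ENNReal) ^ p * (1 - 1 / 16) ^ sampleCount p ≤ 1 / 32 := by
  have h1 : (1 - 1 / 16 : ENNReal) = ENNReal.ofReal (15 / 16) := by
    rw [show (15 / 16 : ℝ) = 1 - 1 / 16 by norm_num, ENNReal.ofReal_sub _ (by norm_num),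
      ENNReal.ofReal_div_of_pos (by norm_num)]
    simp
  have h2 : (1 / 32 : ENNReal) = ENNReal.ofReal (1 / 32) := by
    rw [ENNReal.ofReal_div_of_pos (by norm_num)]
    simp
  have h3 : (2 : ENNReal) = ENNReal.ofReal 2 := by simp
  rw [h1, h2, h3, ← ENNReal.ofReal_pow (by norm_num), ← ENNReal.ofReal_pow (by norm_num),
    ← ENNReal.ofReal_mul (by positivity)]
  refine ENNReal.ofReal_le_ofReal ?_
  calc (2 : ℝ) ^ p * (15 / 16) ^ sampleCount p
      = 2 ^ p * ((15 / 16) ^ 11) ^ (p + 10) := by rw [sampleCount, pow_mul]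
    _ ≤ 2 ^ p * (1 / 2) ^ (p + 10) := by
        gcongr
        norm_num
    _ = (1 / 2) ^ 10 := by
        rw [pow_add, ← mul_assoc, ← mul_pow]
        norm_num
    _ ≤ 1 / 32 := by norm_num

/-- The error budget is `1/16 + 1/32 + 1/32`; the middle term fits eventually, being polynomial
times negligible. -/
theorem eventually_learner_bound_le {p : ℕ → ℕ} (hp : PolyBounded p) {ν : ℕ → ℝ}
    (hν : Negligible ν) : ∀ᶠ n in Filter.atTop,
      1 / 16 + (sampleCount (p n) : ENNReal) * ENNReal.ofReal (ν n) +
        2 ^ p n * (1 - 1 / 16) ^ sampleCount (p n) ≤ 1 / 8 := by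
  filter_upwards [hν.eventually_mul_le hp.sampleCount (c := 1 / 32) (by norm_num)] with n hn
  have h1 : (sampleCount (p n) : ENNReal) * ENNReal.ofReal (ν n) ≤ 1 / 32 := by
    rw [← ENNReal.ofReal_natCast, ← ENNReal.ofReal_mul (by positivity)]
    refine (ENNReal.ofReal_le_ofReal hn).trans_eq ?_
    rw [ENNReal.ofReal_div_of_pos (by norm_num)]
    simp
  refine (add_le_add (add_le_add_right h1 _) (two_pow_mul_pow_sampleCount_le _)).trans_eq ?_
  rw [← ENNReal.toReal_eq_toReal_iff' (by finiteness) (by finiteness),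
    ENNReal.toReal_add (by finiteness) (by finiteness),
    ENNReal.toReal_add (by finiteness) (by finiteness)]
  simp
  norm_num

theorem le_quarter_of_le_eighth {a : ENNReal} (h : a ≤ 1 / 8) : a ≤ 1 / 4 :=
  h.trans (ENNReal.div_le_div_left (by norm_num) _)

theorem two_mul_le_quarter {a : ENNReal} (h : a ≤ 1 / 8) : 2 * a ≤ 1 / 4 := by
  refine (mul_le_mul_right h 2).trans_eq ?_
  rw [← ENNReal.toReal_eq_toReal_iff' (by finiteness) (by finiteness)]
  simp
  norm_num

/-- A game that is eventually lost with probability at most `1 / 4` is not won with probability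
at most `1 / 2` up to a negligible amount. -/
theorem not_negligible_advantage {G : ℕ → PMF Bool}
    (hG : ∀ᶠ n in Filter.atTop, G n false ≤ 1 / 4) :
    ¬ ∃ ν, Negligible ν ∧ ∀ n, (G n true).toReal ≤ 1 / 2 + ν n := by
  rintro ⟨ν, hν, h⟩
  -- Any constant up to `1/4` would do, since the game is won with probability at least `3/4` for
  -- large `n`.
  have h8 : ∀ᶠ n in Filter.atTop, ν n < 1 / 8 :=
    hν.tendsto_zero.eventually (gt_mem_nhds (by norm_num))
  obtain ⟨n, h1, h2⟩ := (hG.and h8).exists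
  have h3 := h n
  have h4 := ENNReal.toReal_mono (by finiteness) h1
  rw [PMF.bool_apply_true, ENNReal.toReal_sub_of_le (PMF.coe_le_one _ _) (by finiteness)] at h3
  simp at h3 h4
  linarith

/-- A game that is eventually lost with probability at most `1 / 4` is not won with negligible
probability only. -/
theorem not_negligible_success {G : ℕ → PMF Bool}
    (hG : ∀ᶠ n in Filter.atTop, G n false ≤ 1 / 4) :
    ¬ ∃ ν, Negligible ν ∧ ∀ n, (G n true).toReal ≤ ν n := by
  rintro ⟨ν, hν, h⟩
  exact not_negligible_advantage hG ⟨ν, hν, fun n => (h n).trans (by linarith)⟩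

theorem one_sub_le_ofReal {p : ENNReal} (hp : p ≤ 1) {ν : ℝ} (h : 1 - ν ≤ p.toReal) :
    1 - p ≤ ENNReal.ofReal ν := by
  rw [← ENNReal.ofReal_toReal (ne_top_of_le_ne_top ENNReal.one_ne_top hp), ← ENNReal.ofReal_one,
    ← ENNReal.ofReal_sub _ ENNReal.toReal_nonneg]
  exact ENNReal.ofReal_le_ofReal (by linarith)

/-! ### Receivers, programs and splitters -/

/-- Apply a function to the result of a receiver. -/
noncomputable def Receiver.map {α β : Type} (f : α → β) :
    {ds : List ℕ} → Receiver α ds → Receiver β ds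
  | [], R => PMF.map f R
  | _ :: _, ⟨m, E, next⟩ => ⟨m, E, fun i => (next i).map f⟩

theorem Receiver.run_map {α β : Type} (f : α → β) {ds : List ℕ} (R : Receiver α ds)
    (σ : Signal ds) : (R.map f).run σ = (R.run σ).map f := by
  induction ds with
  | nil => rfl
  | cons d ds ih =>
    obtain ⟨m, E, next⟩ := R
    obtain ⟨ρ, σ⟩ := σ
    simp only [Receiver.map, Receiver.run, ih, PMF.map_bind]

/-- Ask the query `q` for `T` times, decode the answers, and continue with the list of the
results. -/
def Prog.collect {Q : Type} {A : Q → Type} {α K : Type} (q : Q) (decode : A q → K)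
    (next : List K → Prog Q A α) : ℕ → List K → Prog Q A α
  | 0, l => next l
  | T + 1, l => .ask q fun a => collect q decode next T (decode a :: l)

theorem Prog.eval_collect {Q : Type} {A : Q → Type} {α K : Type} (oracle : ∀ q, PMF (A q))
    (q : Q) (decode : A q → K) (next : List K → Prog Q A α) (T : ℕ) (l : List K) :
    (Prog.collect q decode next T l).eval oracle =
      (((oracle q).map decode).samples T l).bind fun l' => (next l').eval oracle := by
  induction T generalizing l with
  | zero => simp [Prog.collect, PMF.samples, PMF.pure_bind]
  | succ T ih =>
    simp only [Prog.collect, Prog.eval, PMF.samples, ih, PMF.bind_bind, PMF.bind_map,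
      Function.comp_def]

/-- The continuation has to fit every budget, even 0, so it asks nothing of positive weight; the
cost is that of the `T` repeated queries. -/
theorem Prog.costLE_collect {Q : Type} {A : Q → Type} {α K : Type} {w : Q → ℕ} {q : Q}
    {decode : A q → K} {next : List K → Prog Q A α} (hnext : ∀ l t, (next l).CostLE w t)
    {T t : ℕ} (l : List K) (h : T * w q ≤ t) :
    (Prog.collect q decode next T l).CostLE w t := by
  induction T generalizing l t with
  | zero => exact hnext l t
  | succ T ih =>
    rw [Nat.add_mul, Nat.one_mul] at h
    exact ⟨by omega, fun a => ih _ (by omega)⟩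

/-- The measurement with a single outcome. -/
def POVM.trivial (d : ℕ) : POVM d (Fin 1) where
  effect _ := 1
  posSemidef _ := Matrix.PosSemidef.one
  sum_eq_one := by simp

/-- The receiver that ignores the transmission. -/
noncomputable def Receiver.ignore {α : Type} (p : PMF α) : (ds : List ℕ) → Receiver α ds
  | [] => p
  | d :: ds => ⟨1, POVM.trivial d, fun _ => Receiver.ignore p ds⟩

/-- A measurement, seen as an instrument with two empty output registers. -/
theorem POVM.exists_splitOp {d m : ℕ} (E : POVM d (Fin m)) :
    ∃ K : SplitOp d 0 0 m (Fintype.card (Qubits d)),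
      ∀ x, (K.join (POVM.trivial 0) (POVM.trivial 0)).effect x = E.effect x.1 := by
  choose B hB using fun i =>
    CStarAlgebra.nonneg_iff_eq_star_mul_self.1 (E.posSemidef i).nonneg
  -- With `E i = (B i)ᴴ B i` and a one-dimensional output space, the rows of `B i` serve as Kraus
  -- operators.
  let row (i : Fin m) (k : Fin (Fintype.card (Qubits d))) :
      Matrix (Qubits 0 × Qubits 0) (Qubits d) ℂ :=
    Matrix.of fun _ y => B i ((Fintype.equivFin (Qubits d)).symm k) y
  have hrow : ∀ i, ∑ k, (row i k)ᴴ * row i k = E.effect i := by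
    intro i
    rw [hB i]
    ext y z
    simp only [Matrix.sum_apply, Matrix.mul_apply, Matrix.star_apply, row,
      Matrix.conjTranspose_apply, Matrix.of_apply, Finset.sum_const, Finset.card_univ]
    simp only [Fintype.card_prod, Fintype.card_pi, Finset.univ_eq_empty, Finset.prod_empty,
      mul_one, one_smul]
    exact (Fintype.equivFin (Qubits d)).symm.sum_comp
      fun j => star (B i j y) * B i j z
  refine ⟨⟨row, ?_⟩, fun x => ?_⟩
  · simp only [hrow, E.sum_eq_one]
  · simp only [SplitOp.join, POVM.trivial, Matrix.one_kronecker_one, Matrix.mul_one, hrow]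

/-- The more likely one of two outcomes. -/
noncomputable def PMF.majority (p : PMF Bool) : Bool := by
  classical exact decide (p false ≤ p true)

/-- If rounding gives the wrong bit, the wrong bit had probability at least `1/2`. This is the price
of a splitter having no randomness after its last round. -/
theorem PMF.ite_majority_le (p : PMF Bool) (b : Bool) :
    (if p.majority = b then 0 else 1) ≤ 2 * p (!b) := by
  classical
  have h : p true + p false = 1 := by simpa [tsum_fintype] using p.tsum_coe
  unfold majority
  split_ifs with hm
  · exact zero_le
  · rw [← h, two_mul]
    cases b
    · have hm : p false ≤ p true := by simpa using hm
      exact add_le_add_right hm _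
    · have hm : p true < p false := by simpa using hm
      exact add_le_add_left hm.le _

/-- A receiver of a bit, turned into a splitter that sends nothing and rounds the random result
of the receiver. -/
noncomputable def Receiver.toSplitter :
    {ds : List ℕ} → Receiver Bool ds → Splitter Bits 0 0 ds
  | [], R => [PMF.majority R]
  | d :: _, ⟨m, E, next⟩ =>
      ⟨m, Fintype.card (Qubits d), E.exists_splitOp.choose, fun i => (next i).toSplitter⟩

/-- Joined with trivial measurements, each instrument reproduces the outcome law of the original
measurement, so only the final rounding costs a factor 2. Here `f` is the loss, which vanishes when
the recorded bit is right. -/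
theorem Receiver.expect_toSplitter_le {β γ : Type} {ds : List ℕ} (R : Receiver Bool ds)
    (y : β) (z : γ) (σ : Signal ds) (b : Bool) {f : Bits × β × γ → ENNReal}
    (hf : f ([b], y, z) = 0) (hf' : ∀ x, f x ≤ 1) :
    (R.toSplitter.run (Receiver.ignore (PMF.pure y) _) (Receiver.ignore (PMF.pure z) _) σ).expect f
      ≤ 2 * R.run σ (!b) := by
  induction ds with
  | nil =>
    have h : (Receiver.toSplitter R).run (Receiver.ignore (PMF.pure y) [])
        (Receiver.ignore (PMF.pure z) []) σ = PMF.pure ([PMF.majority R], y, z) := by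
      simp [Splitter.run, Receiver.ignore, PMF.pure_bind, PMF.pure_map, Receiver.toSplitter]
    refine le_trans ?_ (PMF.ite_majority_le R b)
    refine (congrArg (fun p => PMF.expect p f) h).trans_le ?_
    rw [PMF.expect_pure]
    split_ifs with hm
    · rw [hm, hf]
    · exact hf' _
  | cons d ds ih =>
    obtain ⟨m, E, next⟩ := R
    obtain ⟨ρ, σ⟩ := σ
    have hK := E.exists_splitOp.choose_spec
    set K := E.exists_splitOp.choose with hKdef
    have hrun : Splitter.run (Receiver.toSplitter (ds := d :: ds) ⟨m, E, next⟩)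
        (Receiver.ignore (PMF.pure y) ((d :: ds).map fun _ => 0))
        (Receiver.ignore (PMF.pure z) ((d :: ds).map fun _ => 0)) (ρ, σ) =
        ((K.join (POVM.trivial 0) (POVM.trivial 0)).measure ρ).bind fun x =>
          (next x.1).toSplitter.run (Receiver.ignore (PMF.pure y) _)
            (Receiver.ignore (PMF.pure z) _) σ := rfl
    have hR : Receiver.run (ds := d :: ds) ⟨m, E, next⟩ (ρ, σ) =
        (E.measure ρ).bind fun i => (next i).run σ := rfl
    rw [hrun, hR, PMF.expect_bind, PMF.bind_apply_eq_expect, ← PMF.expect_const_mul]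
    refine (PMF.expect_mono _ fun x : Fin m × Fin 1 × Fin 1 => ih (next x.1) σ).trans_eq ?_
    simp only [PMF.expect, tsum_fintype, POVM.measure, PMF.ofFintype_apply, hK,
      Fintype.sum_prod_type]
    simp

/-- Bit strings of a given length as classical memory of an adversary. -/
theorem map_decode_ofFn {m : ℕ} (p : PMF (Fin m → Bool)) :
    ((p.map List.ofFn).map fun (l : Bits) (i : Fin m) => l.getD i false) = p := by
  rw [PMF.map_comp]
  convert p.map_id
  ext k i
  simp

/-! ### Attacks on encryption schemes -/

namespace EncScheme

variable {Msg : ℕ → Type}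

/-- The law of the key that an honest user extracts from a copy of the public key. -/
noncomputable def extract (S : EncScheme Msg) (n : ℕ) (sk : S.SK n) : PMF (S.Key n) :=
  (S.keySend n sk).bind (S.keyReceive n).run

/-- Exhibits the hidden key as a sample of the same law that the adversary can sample, as
`exists_learner` requires. -/
theorem setup_eq (S : EncScheme Msg) (n : ℕ) :
    S.setup n = (S.gen n).bind fun sk => (S.extract n sk).bind fun k => PMF.pure (sk, k) := by
  simp only [extract, PMF.bind_bind]
  rfl

/-- The query for a copy of the public key, processed as by an honest user. -/
noncomputable def extractQuery (S : EncScheme Msg) (n : ℕ) : S.Query n :=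
  .key ((S.keyReceive n).map List.ofFn)

/-- The key in the answer to `extractQuery`. -/
def decodeKey (S : EncScheme Msg) (n : ℕ) : S.Answer n (S.extractQuery n) → S.Key n :=
  fun (l : Bits) i => l.getD i false

/-- Extract keys from `sampleCount (S.skLen n)` copies of the public key. -/
noncomputable def learn (S : EncScheme Msg) (n : ℕ) {α : Type}
    (next : List (S.Key n) → S.Attack n α) : S.Attack n α :=
  Prog.collect (S.extractQuery n) (S.decodeKey n) next (sampleCount (S.skLen n)) []

/-- Answers to public key queries do not depend on `k`, and decoding undoes `List.ofFn`; hence the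
collected keys are independent samples of `extract sk`. -/
theorem eval_learn (S : EncScheme Msg) (n : ℕ) {α : Type}
    (next : List (S.Key n) → S.Attack n α) (sk : S.SK n) (k : S.Key n) :
    (S.learn n next).eval (S.oracle n sk k) =
      ((S.extract n sk).samples (sampleCount (S.skLen n)) []).bind
        fun l => (next l).eval (S.oracle n sk k) := by
  have h : (S.oracle n sk k (S.extractQuery n)).map (S.decodeKey n) = S.extract n sk := by
    rw [← map_decode_ofFn (S.extract n sk), extract, PMF.map_bind (f := List.ofFn)]
    simp only [← Receiver.run_map]
    rfl
  rw [learn, Prog.eval_collect, h]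

/-- The receiver that decrypts and compares the result with `μ₁`. -/
noncomputable def decBit (S : EncScheme Msg) (n : ℕ) (μ₁ : Msg n) (sk : S.SK n) :
    Receiver Bool (S.ctFmt n) := by
  classical exact (S.dec n sk).map fun m => decide (m = μ₁)

/-- A correct decryption always gives the correct bit, because `μ₀ ≠ μ₁`; other messages can only
help. -/
theorem decBit_run_not_le (S : EncScheme Msg) (n : ℕ) {μ₀ μ₁ : Msg n} (h : μ₀ ≠ μ₁)
    (sk : S.SK n) (b : Bool) (ρ : Signal (S.ctFmt n)) :
    (S.decBit n μ₁ sk).run ρ (!b) ≤ 1 - (S.dec n sk).run ρ (if b then μ₁ else μ₀) := by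
  classical
  rw [PMF.bool_apply_not, decBit, Receiver.run_map]
  refine tsub_le_tsub_left ?_ 1
  have hb : decide ((if b then μ₁ else μ₀) = μ₁) = b := by
    cases b <;> simp [h]
  have := PMF.apply_le_map_apply ((S.dec n sk).run ρ) (fun m => decide (m = μ₁))
    (if b then μ₁ else μ₀)
  rwa [hb] at this

/-- The probability that decryption with `sk` does not recognize which of the two messages has
been encrypted with `k`. -/
noncomputable def guessError (S : EncScheme Msg) (n : ℕ) (μ₀ μ₁ : Msg n) (sk : S.SK n)
    (k : S.Key n) : ENNReal :=
  fairCoin.expect fun b => (S.enc n k (if b then μ₁ else μ₀)).expect fun ρ =>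
    (S.decBit n μ₁ sk).run ρ (!b)

theorem guessError_le_one (S : EncScheme Msg) (n : ℕ) (μ₀ μ₁ : Msg n) (sk : S.SK n)
    (k : S.Key n) : S.guessError n μ₀ μ₁ sk k ≤ 1 :=
  PMF.expect_le_one _ fun _ => PMF.expect_le_one _ fun _ => PMF.coe_le_one _ _

theorem expect_guessError_le (S : EncScheme Msg) (n : ℕ) {μ₀ μ₁ : Msg n} (h : μ₀ ≠ μ₁) :
    ((S.gen n).expect fun sk => (S.extract n sk).expect (S.guessError n μ₀ μ₁ sk)) ≤
      (1 - S.decryption n μ₀ μ₀) + (1 - S.decryption n μ₁ μ₁) := by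
  have key : ∀ μ, 1 - S.decryption n μ μ = (S.gen n).expect fun sk =>
      (S.extract n sk).expect fun k => (S.enc n k μ).expect fun ρ =>
        1 - (S.dec n sk).run ρ μ := by
    intro μ
    have hd : S.decryption n μ = (S.gen n).bind fun sk => (S.extract n sk).bind fun k =>
        (S.enc n k μ).bind fun ρ => (S.dec n sk).run ρ := by
      have : S.decryption n μ = (S.setup n).bind fun x =>
        (S.enc n x.2 μ).bind fun ρ => (S.dec n x.1).run ρ := rfl
      rw [this, setup_eq]
      simp only [PMF.bind_bind, PMF.pure_bind]
    rw [hd]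
    simp only [PMF.bind_apply_eq_expect]
    have h1 : ∀ sk k, ((S.enc n k μ).expect fun ρ => (S.dec n sk).run ρ μ) ≤ 1 :=
      fun sk k => PMF.expect_le_one _ fun _ => PMF.coe_le_one _ _
    simp only [PMF.expect_one_sub _ fun _ => PMF.coe_le_one _ _, PMF.expect_one_sub _ (h1 _)]
    rw [PMF.expect_one_sub _ fun sk => PMF.expect_le_one _ (h1 sk)]
  rw [key, key, ← PMF.expect_add]
  refine PMF.expect_mono _ fun sk => ?_
  rw [← PMF.expect_add]
  refine PMF.expect_mono _ fun k => ?_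
  -- The bound becomes an average over `b`, so that each value of `b` can be charged to its own
  -- summand.
  rw [← fairCoin.expect_const (_ + _)]
  refine PMF.expect_mono _ fun b => ?_
  refine (PMF.expect_mono _ fun ρ => S.decBit_run_not_le n h sk b ρ).trans ?_
  cases b
  · exact le_self_add
  · exact le_add_self

/-- The probability that the guess fails that is obtained by decrypting with a private key
computed by `pick` from extracted keys. -/
noncomputable def attackError (S : EncScheme Msg) (n : ℕ) (μ₀ μ₁ : Msg n)
    (pick : List (S.Key n) → S.SK n) : ENNReal :=
  (S.gen n).expect fun sk => (S.extract n sk).expect fun k => fairCoin.expect fun b =>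
    ((S.extract n sk).samples (sampleCount (S.skLen n)) []).expect fun l =>
      (S.enc n k (if b then μ₁ else μ₀)).expect fun ρ => (S.decBit n μ₁ (pick l)).run ρ (!b)

theorem exists_eventually_attackError_le (S : EncScheme Msg) (hS : S.Correct)
    {μ₀ μ₁ : ∀ n, Msg n} (h : ∀ n, μ₀ n ≠ μ₁ n) :
    ∃ pick : ∀ n, List (S.Key n) → S.SK n, ∀ᶠ n in Filter.atTop,
      S.attackError n (μ₀ n) (μ₁ n) (pick n) ≤ 1 / 8 := by
  choose pick hpick using fun n => exists_learner (S.gen n) (S.extract n)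
    (S.guessError_le_one n (μ₀ n) (μ₁ n)) (sampleCount (S.skLen n)) (1 / 16)
  refine ⟨pick, ?_⟩
  obtain ⟨ν₀, hν₀, h₀⟩ := hS μ₀
  obtain ⟨ν₁, hν₁, h₁⟩ := hS μ₁
  -- `ENNReal.ofReal` is additive on nonnegative numbers only; here the correctness bounds force
  -- nonnegativity.
  have nonneg : ∀ {p : ENNReal} {ν : ℝ}, p ≤ 1 → 1 - ν ≤ p.toReal → 0 ≤ ν := by
    intro p ν hp hν
    have := ENNReal.toReal_mono ENNReal.one_ne_top hp
    rw [ENNReal.toReal_one] at this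
    linarith
  filter_upwards [eventually_learner_bound_le S.skLen_poly (hν₀.add hν₁)] with n hn
  -- The challenge bit is independent of the samples, so it can be averaged last, inside
  -- `guessError`.
  have hswap : S.attackError n (μ₀ n) (μ₁ n) (pick n) = (S.gen n).expect fun sk =>
      (S.extract n sk).expect fun k =>
        ((S.extract n sk).samples (sampleCount (S.skLen n)) []).expect fun l =>
          S.guessError n (μ₀ n) (μ₁ n) (pick n l) k := by
    simp only [attackError, guessError]
    congr! 4 with sk k
    rw [PMF.expect_comm]
  rw [hswap]
  refine ((hpick n).trans ?_).trans hn
  have hcard : (Fintype.card (Fin (S.skLen n) → Bool) : ENNReal) = 2 ^ S.skLen n := by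
    simp
  rw [hcard]
  gcongr
  refine (S.expect_guessError_le n (h n)).trans ?_
  have hle : ∀ μ : Msg n, S.decryption n μ μ ≤ 1 := fun μ => PMF.coe_le_one _ _
  rw [Pi.add_apply, ENNReal.ofReal_add (nonneg (hle _) (h₀ n)) (nonneg (hle _) (h₁ n))]
  exact add_le_add (one_sub_le_ofReal (hle _) (h₀ n)) (one_sub_le_ofReal (hle _) (h₁ n))

theorem costLE_learn (S : EncScheme Msg) (n : ℕ) {α : Type}
    {next : List (S.Key n) → S.Attack n α} {w : S.Query n → ℕ}
    (hnext : ∀ l t, (next l).CostLE w t) {t : ℕ}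
    (h : sampleCount (S.skLen n) * w (S.extractQuery n) ≤ t) : (S.learn n next).CostLE w t :=
  Prog.costLE_collect hnext [] h

theorem not_keyOnlyIndist (S : EncScheme Msg) (hS : S.Correct) {μ₀ μ₁ : ∀ n, Msg n}
    (h : ∀ n, μ₀ n ≠ μ₁ n) : ¬ S.KeyOnlyIndist μ₀ μ₁ := by
  obtain ⟨pick, hpick⟩ := S.exists_eventually_attackError_le hS h
  let adv : ∀ n, S.Attack n (Receiver Bool (S.ctFmt n)) := fun n =>
    S.learn n fun l => .ret (S.decBit n (μ₁ n) (pick n l))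
  intro hsec
  refine not_negligible_advantage ?_ (hsec adv
    ⟨_, S.skLen_poly.sampleCount, fun n =>
      S.costLE_learn n (fun _ _ => by trivial) (Nat.mul_one _).le⟩
    fun n => S.costLE_learn n (fun _ _ => by trivial) (Nat.mul_zero _).le)
  filter_upwards [hpick] with n hn
  refine le_quarter_of_le_eighth (le_trans (le_of_eq ?_) hn)
  have hexp : S.keyOnlyExp n (μ₀ n) (μ₁ n) (adv n) = (S.setup n).bind fun x =>
      fairCoin.bind fun b => ((adv n).eval (S.oracle n x.1 x.2)).bind fun R =>
        (S.enc n x.2 (if b then μ₁ n else μ₀ n)).bind fun ρ =>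
          (R.run ρ).bind fun b' => PMF.pure (b' == b) := rfl
  simp only [hexp, setup_eq, adv, eval_learn, Prog.eval, PMF.bind_bind, PMF.pure_bind,
    PMF.bind_apply_eq_expect, PMF.expect_pure_beq, attackError]

/-- The guess is already made while the ciphertext is received; the private key revealed later is
ignored. -/
theorem not_qdcca1 (S : EncScheme Msg) (hS : S.Correct) {μ₀ μ₁ : ∀ n, Msg n}
    (h : ∀ n, μ₀ n ≠ μ₁ n) : ¬ S.QDCCA1 := by
  obtain ⟨pick, hpick⟩ := S.exists_eventually_attackError_le hS h
  let adv : S.DisAdversary :=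
    { choose := fun n => S.learn n fun l =>
        .ret (μ₀ n, μ₁ n, (S.decBit n (μ₁ n) (pick n l)).map fun b => [b])
      guess := fun n x _ => .ret (x == [true]) }
  intro hsec
  refine not_negligible_advantage ?_ (hsec adv
    ⟨_, S.skLen_poly.sampleCount, fun n =>
      ⟨S.costLE_learn n (fun _ _ => by trivial) (Nat.mul_one _).le,
        fun _ _ => ⟨trivial, trivial⟩⟩⟩)
  filter_upwards [hpick] with n hn
  refine le_quarter_of_le_eighth (le_trans (le_of_eq ?_) hn)
  have hexp : S.disExp adv n = (S.setup n).bind fun x =>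
      fairCoin.bind fun b => ((adv.choose n).eval (S.oracle n x.1 x.2)).bind fun y =>
        (S.enc n x.2 (if b then y.2.1 else y.1)).bind fun ρ =>
          (y.2.2.run ρ).bind fun z => ((adv.guess n z x.1).eval (S.oracle n x.1 x.2)).bind
            fun b' => PMF.pure (b' == b) := rfl
  have hbit : ∀ b : Bool, (([b] : Bits) == [true]) = b := by decide
  simp only [hexp, setup_eq, adv, eval_learn, Prog.eval, PMF.bind_bind, PMF.pure_bind,
    Receiver.run_map, PMF.bind_map, Function.comp_def, hbit,
    PMF.bind_apply_eq_expect, PMF.expect_pure_beq, attackError]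

/-- The splitter decrypts by itself, feeds empty registers to both parties, and sends each the
resulting bit as the last classical message. Both are then right or wrong together. -/
theorem not_qucca (S : EncScheme Msg) (hS : S.Correct) {μ₀ μ₁ : ∀ n, Msg n}
    (h : ∀ n, μ₀ n ≠ μ₁ n) : ¬ S.QUCCA := by
  obtain ⟨pick, hpick⟩ := S.exists_eventually_attackError_le hS h
  let out : Bits → PMF Bool := fun y => PMF.pure (y == [true])
  let adv : S.UncAdversary :=
    { f₁ := fun _ => 0
      f₂ := fun _ => 0
      choose := fun n => S.learn n fun l =>
        .ret (μ₀ n, μ₁ n, (S.decBit n (μ₁ n) (pick n l)).toSplitter)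
      finish := fun _ x => .ret (x, x)
      fst := fun _ _ => Receiver.ignore (PMF.pure out) _
      snd := fun _ _ => Receiver.ignore (PMF.pure out) _ }
  intro hsec
  refine not_negligible_advantage ?_ (hsec adv
    ⟨_, S.skLen_poly.sampleCount, fun n =>
      ⟨S.costLE_learn n (fun _ _ => by trivial) (Nat.mul_one _).le,
        fun _ => ⟨trivial, trivial⟩⟩⟩)
  filter_upwards [hpick] with n hn
  have hexp : S.uncExp adv n = (S.setup n).bind fun x =>
      fairCoin.bind fun b => ((adv.choose n).eval (S.oracle n x.1 x.2)).bind fun y =>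
        (S.enc n x.2 (if b then y.2.1 else y.1)).bind fun ρ =>
          (y.2.2.run (adv.fst n x.1) (adv.snd n x.1) ρ).bind fun z =>
            ((adv.finish n z.1).eval (S.oracle n x.1 x.2)).bind fun w =>
              (z.2.1 w.1).bind fun b₁ => (z.2.2 w.2).bind fun b₂ =>
                PMF.pure (b₁ == b && b₂ == b) := rfl
  have hle : S.uncExp adv n false ≤ 2 * S.attackError n (μ₀ n) (μ₁ n) (pick n) := by
    simp only [hexp, setup_eq, adv, eval_learn, Prog.eval, PMF.bind_bind, PMF.pure_bind,
      PMF.bind_apply_eq_expect, attackError, ← PMF.expect_const_mul]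
    refine PMF.expect_mono _ fun sk => PMF.expect_mono _ fun k => PMF.expect_mono _ fun b =>
      PMF.expect_mono _ fun l => PMF.expect_mono _ fun ρ => ?_
    refine Receiver.expect_toSplitter_le _ _ _ _ _ ?_ fun x => ?_
    · simp only [out, PMF.expect_pure]
      cases b <;> simp
    · exact PMF.expect_le_one _ fun _ => PMF.expect_le_one _ fun _ => PMF.coe_le_one _ _
  exact hle.trans (two_mul_le_quarter hn)

end EncScheme

/-! ### Attacks on signature schemes -/

namespace SigScheme

variable {Msg : ℕ → Type}

/-- The law of the key that an honest user extracts from a copy of the public key. -/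
noncomputable def extract (S : SigScheme Msg) (n : ℕ) (sk : S.SK n) : PMF (S.Key n) :=
  (S.keySend n sk).bind (S.keyReceive n).run

theorem setup_eq (S : SigScheme Msg) (n : ℕ) :
    S.setup n = (S.gen n).bind fun sk => (S.extract n sk).bind fun k => PMF.pure (sk, k) := by
  simp only [extract, PMF.bind_bind]
  rfl

/-- The query for a copy of the public key, processed as by an honest user. -/
noncomputable def extractQuery (S : SigScheme Msg) (n : ℕ) : S.Query n :=
  .key ((S.keyReceive n).map List.ofFn)

/-- The key in the answer to `extractQuery`. -/
def decodeKey (S : SigScheme Msg) (n : ℕ) : S.Answer n (S.extractQuery n) → S.Key n :=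
  fun (l : Bits) i => l.getD i false

/-- A signature of `μ` under a private key computed by `pick` from keys that are extracted from
`sampleCount (S.skLen n)` copies of the public key; the output is a function of it. -/
noncomputable def forgery (S : SigScheme Msg) (n : ℕ) (μ : Msg n)
    (pick : List (S.Key n) → S.SK n) {α : Type} (out : Signal (S.sigFmt n) → α) :
    S.Attack n α :=
  Prog.collect (S.extractQuery n) (S.decodeKey n)
    (fun l => .coin (S.sign n (pick l) μ).exists_map_nat_eq.choose fun i =>
      .ret (out ((S.sign n (pick l) μ).exists_map_nat_eq.choose_spec.choose i)))
    (sampleCount (S.skLen n)) []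

/-- A program can only toss coins with values in `ℕ`; since discrete laws have countable support,
this still allows sampling signals from `sign`. -/
theorem eval_forgery (S : SigScheme Msg) (n : ℕ) (μ : Msg n) (pick : List (S.Key n) → S.SK n)
    {α : Type} (out : Signal (S.sigFmt n) → α) (sk : S.SK n) (k : S.Key n) :
    (S.forgery n μ pick out).eval (S.oracle n sk k) =
      ((S.extract n sk).samples (sampleCount (S.skLen n)) []).bind
        fun l => (S.sign n (pick l) μ).map out := by
  have h : (S.oracle n sk k (S.extractQuery n)).map (S.decodeKey n) = S.extract n sk := by
    rw [← map_decode_ofFn (S.extract n sk), extract, PMF.map_bind (f := List.ofFn)]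
    simp only [← Receiver.run_map]
    rfl
  rw [forgery, Prog.eval_collect, h]
  congr! 2 with l
  conv_rhs => rw [← (S.sign n (pick l) μ).exists_map_nat_eq.choose_spec.choose_spec]
  rw [PMF.map_comp]
  rfl

theorem costLE_forgery (S : SigScheme Msg) (n : ℕ) (μ : Msg n) (pick : List (S.Key n) → S.SK n)
    {α : Type} (out : Signal (S.sigFmt n) → α) {w : S.Query n → ℕ} {t : ℕ}
    (h : sampleCount (S.skLen n) * w (S.extractQuery n) ≤ t) :
    (S.forgery n μ pick out).CostLE w t :=
  Prog.costLE_collect (fun _ _ => by exact fun _ => trivial) [] h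

/-- The probability that a signature under `sk` is rejected by a user with the key `k`. -/
noncomputable def signError (S : SigScheme Msg) (n : ℕ) (μ : Msg n) (sk : S.SK n)
    (k : S.Key n) : ENNReal :=
  (S.sign n sk μ).expect fun ρ => (S.verify n k μ).run ρ false

theorem signError_le_one (S : SigScheme Msg) (n : ℕ) (μ : Msg n) (sk : S.SK n) (k : S.Key n) :
    S.signError n μ sk k ≤ 1 :=
  PMF.expect_le_one _ fun _ => PMF.coe_le_one _ _

theorem expect_signError (S : SigScheme Msg) (n : ℕ) (μ : Msg n) :
    ((S.gen n).expect fun sk => (S.extract n sk).expect (S.signError n μ sk)) =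
      1 - S.verification n μ true := by
  have h : S.verification n μ = (S.setup n).bind fun x =>
    (S.sign n x.1 μ).bind fun ρ => (S.verify n x.2 μ).run ρ := rfl
  rw [← PMF.bool_apply_not, Bool.not_true, h, setup_eq]
  simp only [PMF.bind_bind, PMF.pure_bind, PMF.bind_apply_eq_expect]
  rfl

/-- The probability that a forged signature is rejected. -/
noncomputable def forgeryError (S : SigScheme Msg) (n : ℕ) (μ : Msg n)
    (pick : List (S.Key n) → S.SK n) : ENNReal :=
  (S.gen n).expect fun sk => (S.extract n sk).expect fun k =>
    ((S.extract n sk).samples (sampleCount (S.skLen n)) []).expect fun l =>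
      (S.sign n (pick l) μ).expect fun ρ => (S.verify n k μ).run ρ false

theorem exists_eventually_forgeryError_le (S : SigScheme Msg) (hS : S.Correct)
    (μ : ∀ n, Msg n) : ∃ pick : ∀ n, List (S.Key n) → S.SK n, ∀ᶠ n in Filter.atTop,
      S.forgeryError n (μ n) (pick n) ≤ 1 / 8 := by
  choose pick hpick using fun n => exists_learner (S.gen n) (S.extract n)
    (S.signError_le_one n (μ n)) (sampleCount (S.skLen n)) (1 / 16)
  refine ⟨pick, ?_⟩
  obtain ⟨ν, hν, h⟩ := hS μ
  filter_upwards [eventually_learner_bound_le S.skLen_poly hν] with n hn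
  refine ((hpick n).trans ?_).trans hn
  have hcard : (Fintype.card (Fin (S.skLen n) → Bool) : ENNReal) = 2 ^ S.skLen n := by
    simp
  rw [hcard, expect_signError]
  gcongr
  exact one_sub_le_ofReal (PMF.coe_le_one _ _) (h n)

theorem not_keyOnlyUnforgeable (S : SigScheme Msg) (hS : S.Correct) (μ : ∀ n, Msg n) :
    ¬ S.KeyOnlyUnforgeable μ := by
  obtain ⟨pick, hpick⟩ := S.exists_eventually_forgeryError_le hS μ
  let adv : ∀ n, S.Attack n (Signal (S.sigFmt n)) := fun n => S.forgery n (μ n) (pick n) id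
  intro hsec
  refine not_negligible_success ?_ (hsec adv
    ⟨_, S.skLen_poly.sampleCount, fun n => S.costLE_forgery n _ _ _ (Nat.mul_one _).le⟩
    fun n => S.costLE_forgery n _ _ _ (Nat.mul_zero _).le)
  filter_upwards [hpick] with n hn
  refine le_quarter_of_le_eighth (le_trans (le_of_eq ?_) hn)
  have hexp : S.keyOnlyExp n (μ n) (adv n) = (S.setup n).bind fun x =>
      ((adv n).eval (S.oracle n x.1 x.2)).bind fun ρ => (S.verify n x.2 (μ n)).run ρ := rfl
  simp only [hexp, setup_eq, adv, eval_forgery, PMF.bind_bind, PMF.pure_bind, PMF.map_id,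
    PMF.bind_apply_eq_expect, forgeryError]

/-- The learning stage is left empty: public key copies, still available in the forging stage,
suffice. -/
theorem not_qdcmva (S : SigScheme Msg) (hS : S.Correct) (μ : ∀ n, Msg n) : ¬ S.QDCMVA := by
  obtain ⟨pick, hpick⟩ := S.exists_eventually_forgeryError_le hS μ
  let adv : S.DisAdversary :=
    { learn := fun _ => .ret []
      forge := fun n _ => S.forgery n (μ n) (pick n) fun ρ => (μ n, ρ) }
  intro hsec
  refine not_negligible_success ?_ (hsec adv
    ⟨_, S.skLen_poly.sampleCount, fun n => ⟨trivial, fun _ =>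
      ⟨S.costLE_forgery n _ _ _ (Nat.mul_one _).le,
        S.costLE_forgery n _ _ _ (Nat.mul_zero _).le⟩⟩⟩)
  filter_upwards [hpick] with n hn
  refine le_quarter_of_le_eighth (le_trans (le_of_eq ?_) hn)
  have hexp : S.disExp adv n = (S.setup n).bind fun x =>
      ((adv.learn n).eval (S.oracle n x.1 x.2)).bind fun y =>
        ((adv.forge n y).eval (S.oracle n x.1 x.2)).bind fun z =>
          (S.verify n x.2 z.1).run z.2 := rfl
  simp only [hexp, setup_eq, adv, eval_forgery, Prog.eval, PMF.bind_bind, PMF.pure_bind,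
    PMF.bind_map, Function.comp_def, PMF.bind_apply_eq_expect, forgeryError]

/-- One forged signature is output twice, which is possible because a signal is a classical
description of states; the permitted signature query is not used. -/
theorem not_qucva (S : SigScheme Msg) (hS : S.Correct) (μ : ∀ n, Msg n) : ¬ S.QUCVA := by
  obtain ⟨pick, hpick⟩ := S.exists_eventually_forgeryError_le hS μ
  let adv : S.UncAdversary := fun n =>
    S.forgery n (μ n) (pick n) fun ρ => ((μ n, ρ), (μ n, ρ))
  intro hsec
  refine not_negligible_success ?_ (hsec adv
    ⟨_, S.skLen_poly.sampleCount, fun n =>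
      ⟨S.costLE_forgery n _ _ _ (Nat.mul_one _).le,
        S.costLE_forgery n _ _ _ ((Nat.mul_zero _).trans_le zero_le_one)⟩⟩)
  filter_upwards [hpick] with n hn
  have hexp : S.uncExp adv n = (S.setup n).bind fun x =>
      ((adv n).eval (S.oracle n x.1 x.2)).bind fun z =>
        ((S.verify n x.2 z.1.1).run z.1.2).bind fun v =>
          ((S.verify n x.2 z.2.1).run z.2.2).bind fun v' => PMF.pure (v && v') := rfl
  have hle : S.uncExp adv n false ≤ 2 * S.forgeryError n (μ n) (pick n) := by
    simp only [hexp, setup_eq, adv, eval_forgery, PMF.bind_bind, PMF.pure_bind,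
      PMF.bind_map, Function.comp_def, PMF.bind_apply_eq_expect, forgeryError,
      ← PMF.expect_const_mul]
    refine PMF.expect_mono _ fun sk => PMF.expect_mono _ fun k => PMF.expect_mono _ fun l =>
      PMF.expect_mono _ fun ρ => ?_
    exact PMF.expect_pure_and_le _
  exact hle.trans (two_mul_le_quarter hn)

end SigScheme

theorem theorem0 :
    (∀ (Msg : ℕ → Type) [∀ n, Nontrivial (Msg n)] (S : EncScheme Msg), S.Correct →
      (∀ μ₀ μ₁ : ∀ n, Msg n, (∀ n, μ₀ n ≠ μ₁ n) → ¬ S.KeyOnlyIndist μ₀ μ₁) ∧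
      ¬ S.QDCCA1 ∧ ¬ S.QUCCA) ∧
    (∀ (Msg : ℕ → Type) [∀ n, Nonempty (Msg n)] (S : SigScheme Msg), S.Correct →
      (∀ μ : ∀ n, Msg n, ¬ S.KeyOnlyUnforgeable μ) ∧
      ¬ S.QDCMVA ∧ ¬ S.QUCVA) := by
  constructor
  · intro Msg _ S hS
    choose μ₀ μ₁ h using fun n => exists_pair_ne (Msg n)
    exact ⟨fun _ _ => S.not_keyOnlyIndist hS, S.not_qdcca1 hS h, S.not_qucca hS h⟩
  · intro Msg _ S hS
    have μ : ∀ n, Msg n := fun n => Classical.arbitrary _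
    exact ⟨S.not_keyOnlyUnforgeable hS, S.not_qdcmva hS μ, S.not_qucva hS μ⟩
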